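/- Let $0<a<1$, and let $\Lambda=a\mathbb{Z}+ia\mathbb{Z}\subset\mathbb{C}$. The Fock space $\mathcal F^2(\mathbb{C})$ is the set of entire functions $F$ with $$\|F\|_{\mathcal F}^2=\int_{\mathbb{C}}|F(z)|^2e^{-\pi|z|^2}\,dz<\infty,$$ where $dz$ is Lebesgue measure on $\mathbb{C}$. Let $\varphi(t)=2^{1/4}e^{-\pi t^2}$ be the normalized Gaussian on $\mathbb{R}$ and $$\mathcal B\varphi(z)=2^{1/4}\int_{\mathbb{R}}\varphi(t)\,e^{2\pi tz-\pi t^2-\frac{\pi}{2}z^2}\,dt,\qquad z\in\mathbb{C},$$ its Bargmann transform. Then $|\mathcal B\varphi(z)|=1$ for all $z\in\Lambda$, and if $F\in\mathcal F^2(\mathbb{C})$ satisfies $|F(z)|=1$ $(=|\mathcal B\varphi(z)|)$ for all $z\in\Lambda$, then there exists $\alpha\in\mathbb{R}$ such that $F(z)=e^{i\alpha}$ for all $z\in\mathbb{C}$. -/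

import Mathlib

open MeasureTheory

noncomputable section

/-- The square of the Fock norm, `∫_ℂ |F(z)|² exp(-π|z|²) dz`, with respect to Lebesgue measure
on `ℂ`, as an element of `[0, ∞]`. -/
def fockNormSq (F : ℂ → ℂ) : ENNReal :=
  ∫⁻ z : ℂ, ENNReal.ofReal (‖F z‖ ^ 2 * Real.exp (-Real.pi * ‖z‖ ^ 2))

/-- The Fock space `𝓕²(ℂ)`: the entire functions of finite Fock norm. -/
def fockSpace : Set (ℂ → ℂ) :=
  {F | Differentiable ℂ F ∧ fockNormSq F < ⊤}

/-- The square lattice `aℤ + iaℤ` in `ℂ`. -/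
def squareLattice (a : ℝ) : Set ℂ :=
  {z | ∃ m n : ℤ, z = (a : ℂ) * m + Complex.I * ((a : ℂ) * n)}

/-- The normalized Gaussian `φ(t) = 2^(1/4) exp(-π t²)`. -/
def normalizedGaussian (t : ℝ) : ℂ :=
  (((2 : ℝ) ^ (1 / 4 : ℝ) * Real.exp (-Real.pi * t ^ 2) : ℝ) : ℂ)

/-- The Bargmann transform
`𝓑 f(z) = 2^(1/4) ∫_ℝ f(t) exp(2π t z - π t² - (π/2) z²) dt`. -/
def bargmann (f : ℝ → ℂ) (z : ℂ) : ℂ :=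
  (((2 : ℝ) ^ (1 / 4 : ℝ) : ℝ) : ℂ) *
    ∫ t : ℝ, f t * Complex.exp (2 * Real.pi * t * z - Real.pi * t ^ 2 - Real.pi / 2 * z ^ 2)

end

/-! Averaging `F ^ 2` over circles shows that a Fock function is `O(exp(π/2 (|z| + 1)²))`. Hence
`G(z) = F(az)` has Gaussian rate `πa²/2 < π/2`, and it has modulus 1 on the Gaussian integers.

Compare `G` with the sigma function `σ` of that lattice, for which `|σ(z)| exp(-π|z|²/2)` is doubly
periodic. On the boundaries of large boxes avoiding the lattice, `G/σ` tends to 0, so the maximum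
principle compares `G/σ` with its partial fractions `∑ G(a) / (σ'(a)(z - a))`. Since `|σ'(a)| =
|σ'(0)| exp(π|a|²/2)`, these are bounded by the lattice values of `G`.

This bounds `G` on the unit box with a constant independent of `G` and of its growth constants
(`exists_norm_le_on_unit_box`). Applied to all lattice translates, it bounds `G` on `ℂ`, and
Liouville's theorem makes `G` constant. -/

/-! ### The sigma function of the Gaussian integers: product and zeros -/

/-- The `q`-Pochhammer product `∏ (1 - q^n w)` at the nome `q = exp(-2π)`. -/
noncomputable def pochhammerProd (w : ℂ) : ℂ :=
  ∏' n : ℕ, (1 + -(Complex.exp (-2 * Real.pi) ^ n * w))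

lemma norm_exp_neg_two_pi_lt_one : ‖Complex.exp (-2 * Real.pi)‖ < 1 := by
  rw [Complex.norm_exp]
  simp [Real.pi_pos]

lemma summable_norm_pochhammer (w : ℂ) :
    Summable fun n : ℕ ↦ ‖-(Complex.exp (-2 * Real.pi) ^ n * w)‖ := by
  simp only [norm_neg, norm_mul, norm_pow]
  exact (summable_geometric_of_lt_one (norm_nonneg _) norm_exp_neg_two_pi_lt_one).mul_right _

lemma differentiable_pochhammerProd : Differentiable ℂ pochhammerProd := by
  intro w
  have hs : Summable fun n : ℕ ↦ ‖Complex.exp (-2 * Real.pi)‖ ^ n * (‖w‖ + 1) :=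
    (summable_geometric_of_lt_one (norm_nonneg _) norm_exp_neg_two_pi_lt_one).mul_right _
  have h := Summable.hasProdLocallyUniformlyOn_nat_one_add
    (f := fun n w ↦ -(Complex.exp (-2 * Real.pi) ^ n * w))
    (Metric.isOpen_ball (x := (0 : ℂ)) (ε := ‖w‖ + 1)) hs
    (.of_forall fun n x hx ↦ by
      simp only [norm_neg, norm_mul, norm_pow]
      have : ‖x‖ ≤ ‖w‖ + 1 := by simpa using (mem_ball_zero_iff.mp hx).le
      gcongr) (fun n ↦ by fun_prop)
  have h2 : DifferentiableOn ℂ pochhammerProd (Metric.ball 0 (‖w‖ + 1)) :=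
    h.differentiableOn
      (.of_forall fun _ ↦ by simpa [Finset.prod_fn] using
        DifferentiableOn.finsetProd (fun _ _ ↦ by fun_prop)) Metric.isOpen_ball
  exact h2.differentiableAt (Metric.isOpen_ball.mem_nhds (by simp))

/-- Splitting off the factor `n = 0`. This functional equation is the source of the
quasi-periodicity of sigma under `z ↦ z + i`. -/
lemma pochhammerProd_eq_mul (w : ℂ) :
    pochhammerProd w = (1 - w) * pochhammerProd (Complex.exp (-2 * Real.pi) * w) := by
  unfold pochhammerProd
  rw [tprod_eq_zero_mul' ]
  · simp only [pow_zero, one_mul, pow_succ, mul_assoc, sub_eq_add_neg]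
  · exact multipliable_one_add_of_summable ((summable_nat_add_iff 1).mpr (summable_norm_pochhammer w))

lemma pochhammerProd_ne_zero {w : ℂ} (h : ∀ n : ℕ, Complex.exp (-2 * Real.pi) ^ n * w ≠ 1) :
    pochhammerProd w ≠ 0 := by
  refine tprod_one_add_ne_zero_of_summable (fun n hn ↦ h n ?_) (summable_norm_pochhammer w)
  linear_combination -hn

/-- The cofactor of the simple zero at the origin in `gaussianSigma`. -/
noncomputable def gaussianSigmaCofactor (z : ℂ) : ℂ :=
  Complex.exp (Real.pi / 2 * z ^ 2 - Real.pi * Complex.I * z) *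
    (pochhammerProd (Complex.exp (-2 * Real.pi) * Complex.exp (2 * Real.pi * Complex.I * z)) *
      pochhammerProd (Complex.exp (-2 * Real.pi) * Complex.exp (-(2 * Real.pi * Complex.I * z))))

/-- A multiple of the Weierstrass sigma function of the Gaussian integers, as a product. -/
noncomputable def gaussianSigma (z : ℂ) : ℂ :=
  (1 - Complex.exp (2 * Real.pi * Complex.I * z)) * gaussianSigmaCofactor z

lemma differentiable_gaussianSigmaCofactor : Differentiable ℂ gaussianSigmaCofactor := by
  unfold gaussianSigmaCofactor
  have := differentiable_pochhammerProd
  fun_prop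

lemma differentiable_gaussianSigma : Differentiable ℂ gaussianSigma := by
  unfold gaussianSigma
  have := differentiable_gaussianSigmaCofactor
  fun_prop

/-- The definition isolates the zero at the origin, to compute the derivative there; this form suits
the zero set and the periods. -/
lemma gaussianSigma_eq (z : ℂ) : gaussianSigma z =
    Complex.exp (Real.pi / 2 * z ^ 2 - Real.pi * Complex.I * z) *
    (pochhammerProd (Complex.exp (2 * Real.pi * Complex.I * z)) *
      pochhammerProd (Complex.exp (-2 * Real.pi) *
        Complex.exp (-(2 * Real.pi * Complex.I * z)))) := by
  rw [pochhammerProd_eq_mul (Complex.exp (2 * Real.pi * Complex.I * z)), gaussianSigma,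
    gaussianSigmaCofactor]
  ring

lemma gaussianSigma_zero : gaussianSigma 0 = 0 := by
  simp [gaussianSigma]

lemma gaussianSigmaCofactor_zero_ne_zero : gaussianSigmaCofactor 0 ≠ 0 := by
  have h : pochhammerProd (Complex.exp (-2 * Real.pi)) ≠ 0 := by
    refine pochhammerProd_ne_zero fun n hn ↦ ?_
    rw [← pow_succ, ← Complex.exp_nat_mul] at hn
    have := congrArg norm hn
    rw [Complex.norm_exp] at this
    simp [Real.pi_ne_zero] at this
    norm_cast at this
  simpa [gaussianSigmaCofactor] using h

lemma deriv_gaussianSigma_zero_ne_zero : deriv gaussianSigma 0 ≠ 0 := by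
  have h1 : HasDerivAt (fun z : ℂ ↦ 1 - Complex.exp (2 * Real.pi * Complex.I * z))
      (-(Complex.exp (2 * Real.pi * Complex.I * 0) * (2 * Real.pi * Complex.I * 1))) 0 :=
    (((hasDerivAt_id (0 : ℂ)).const_mul (2 * Real.pi * Complex.I)).cexp).const_sub 1
  have h2 := h1.mul (differentiable_gaussianSigmaCofactor 0).hasDerivAt
  have h3 : deriv gaussianSigma 0 = _ := h2.deriv
  rw [h3]
  simp [gaussianSigmaCofactor_zero_ne_zero, Real.pi_ne_zero]

lemma exists_int_of_exp_eq {z : ℂ} {k : ℤ}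
    (h : Complex.exp (2 * Real.pi * Complex.I * z) = Complex.exp (2 * Real.pi * k)) :
    ∃ m n : ℤ, z = m + n * Complex.I := by
  obtain ⟨m, hm⟩ := Complex.exp_eq_exp_iff_exists_int.mp h
  refine ⟨m, -k, ?_⟩
  have hpi : (2 * Real.pi * Complex.I : ℂ) ≠ 0 := by simp [Real.pi_ne_zero]
  apply mul_left_cancel₀ hpi
  rw [hm]
  push_cast
  linear_combination (2 * Real.pi * k : ℂ) * Complex.I_sq

lemma eq_lattice_of_gaussianSigma_eq_zero {z : ℂ} (hz : gaussianSigma z = 0) :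
    ∃ m n : ℤ, z = m + n * Complex.I := by
  contrapose! hz
  rw [gaussianSigma_eq]
  refine mul_ne_zero (Complex.exp_ne_zero _) (mul_ne_zero ?_ ?_) <;>
    refine pochhammerProd_ne_zero fun n hn ↦ ?_
  · rw [← Complex.exp_nat_mul] at hn
    obtain ⟨a, b, h⟩ := exists_int_of_exp_eq (z := z) (k := n) (by
      apply mul_left_cancel₀ (Complex.exp_ne_zero (n * (-2 * Real.pi : ℂ)))
      rw [hn, ← Complex.exp_add, eq_comm, Complex.exp_eq_one_iff]
      exact ⟨0, by push_cast; ring⟩)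
    exact hz a b h
  · rw [← mul_assoc, ← pow_succ, ← Complex.exp_nat_mul, ← Complex.exp_add] at hn
    obtain ⟨a, b, h⟩ := exists_int_of_exp_eq (z := z) (k := -(n + 1)) (by
      rw [← one_mul (Complex.exp (2 * Real.pi * Complex.I * z)), ← hn, ← Complex.exp_add]
      congr 1
      push_cast; ring)
    exact hz a b h

/-! ### Double periodicity and its consequences -/

/-- The modulus of `gaussianSigma`, weighted so as to be doubly periodic. -/
noncomputable def weightedSigma (z : ℂ) : ℝ :=
  ‖gaussianSigma z‖ * Real.exp (-(Real.pi / 2 * ‖z‖ ^ 2))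

lemma continuous_weightedSigma : Continuous weightedSigma := by
  unfold weightedSigma
  have := differentiable_gaussianSigma.continuous
  fun_prop

lemma norm_gaussianSigma (z : ℂ) :
    ‖gaussianSigma z‖ = weightedSigma z * Real.exp (Real.pi / 2 * ‖z‖ ^ 2) := by
  rw [weightedSigma, mul_assoc, ← Real.exp_add]
  simp

lemma weightedSigma_ne_zero {z : ℂ} (h : ∀ m n : ℤ, z ≠ m + n * Complex.I) :
    weightedSigma z ≠ 0 := by
  refine mul_ne_zero (norm_ne_zero_iff.mpr fun h0 ↦ ?_) (Real.exp_ne_zero _)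
  obtain ⟨m, n, h'⟩ := eq_lattice_of_gaussianSigma_eq_zero h0
  exact h m n h'

/-- The products depend on `z` only through `exp(2πiz)`, and with `y = Im z` the remaining factor
has modulus `exp(-πy² + πy)`. -/
lemma weightedSigma_periodic_one : Function.Periodic weightedSigma 1 := by
  intro z
  have e1 : Complex.exp (2 * Real.pi * Complex.I * (z + 1)) =
      Complex.exp (2 * Real.pi * Complex.I * z) :=
    Complex.exp_eq_exp_iff_exists_int.mpr ⟨1, by push_cast; ring⟩
  have e2 : Complex.exp (-(2 * Real.pi * Complex.I * (z + 1))) =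
      Complex.exp (-(2 * Real.pi * Complex.I * z)) := by
    rw [Complex.exp_neg, e1, Complex.exp_neg]
  unfold weightedSigma
  rw [gaussianSigma_eq, gaussianSigma_eq, e1, e2, norm_mul (Complex.exp _),
    norm_mul (Complex.exp (Real.pi / 2 * z ^ 2 - _)), mul_right_comm,
    mul_right_comm ‖Complex.exp (Real.pi / 2 * z ^ 2 - _)‖]
  congr 1
  rw [Complex.norm_exp, Complex.norm_exp, ← Real.exp_add, ← Real.exp_add,
    ← Complex.normSq_eq_norm_sq, ← Complex.normSq_eq_norm_sq]
  congr 1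
  simp [Complex.normSq_apply, pow_two]
  ring

lemma weightedSigma_periodic_I : Function.Periodic weightedSigma Complex.I := by
  intro z
  set w := Complex.exp (2 * Real.pi * Complex.I * z) with hw
  have e1 : Complex.exp (2 * Real.pi * Complex.I * (z + Complex.I)) =
      Complex.exp (-2 * Real.pi) * w := by
    rw [hw, ← Complex.exp_add]
    congr 1
    linear_combination (2 * Real.pi : ℂ) * Complex.I_sq
  have e2 : Complex.exp (-2 * Real.pi) * Complex.exp (-(2 * Real.pi * Complex.I * (z + Complex.I))) =
      w⁻¹ := by
    rw [hw, ← Complex.exp_neg, ← Complex.exp_add]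
    congr 1
    linear_combination -(2 * Real.pi : ℂ) * Complex.I_sq
  have hw0 : w ≠ 0 := Complex.exp_ne_zero _
  -- The shift by `i` moves one factor between the two products, since `w(1 - w⁻¹) = -(1 - w)`; the
  -- resulting `‖w‖` is cancelled by the change of the Gaussian weight.
  have key : ‖w‖ * ‖pochhammerProd (Complex.exp (-2 * Real.pi) * w) * pochhammerProd w⁻¹‖ =
      ‖pochhammerProd w * pochhammerProd (Complex.exp (-2 * Real.pi) * w⁻¹)‖ := by
    rw [pochhammerProd_eq_mul w, pochhammerProd_eq_mul w⁻¹, ← norm_mul, ← norm_neg]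
    congr 1
    field_simp
    ring
  have hnw : ‖w‖ = Real.exp (-2 * Real.pi * z.im) := by
    rw [hw, Complex.norm_exp]; simp
  unfold weightedSigma
  rw [gaussianSigma_eq, gaussianSigma_eq, e1, e2, Complex.exp_neg, ← hw, norm_mul (Complex.exp _),
    norm_mul (Complex.exp (Real.pi / 2 * z ^ 2 - _)), ← key, hnw, ← mul_assoc, mul_right_comm,
    mul_right_comm _ _ (Real.exp (-(Real.pi / 2 * ‖z‖ ^ 2)))]
  congr 1
  rw [Complex.norm_exp, Complex.norm_exp, ← Real.exp_add, ← Real.exp_add, ← Real.exp_add,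
    ← Complex.normSq_eq_norm_sq, ← Complex.normSq_eq_norm_sq]
  congr 1
  simp [Complex.normSq_apply, pow_two]
  ring

lemma weightedSigma_add_lattice (z : ℂ) (m n : ℤ) :
    weightedSigma (z + (m + n * Complex.I)) = weightedSigma z := by
  have h1 := weightedSigma_periodic_one.int_mul m
  have h2 := weightedSigma_periodic_I.int_mul n
  rw [← add_assoc, h2, ← mul_one (m : ℂ), h1]

lemma gaussianSigma_lattice (m n : ℤ) : gaussianSigma (m + n * Complex.I) = 0 := by
  rw [← norm_eq_zero, norm_gaussianSigma, ← zero_add ((m : ℂ) + _), weightedSigma_add_lattice]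
  simp [weightedSigma, gaussianSigma_zero]

/-- By periodicity, the difference quotients at a lattice point and at 0 differ in modulus by a
ratio of Gaussian weights; pass to the limit. -/
lemma norm_deriv_gaussianSigma_lattice (m n : ℤ) :
    ‖deriv gaussianSigma (m + n * Complex.I)‖ =
      ‖deriv gaussianSigma 0‖ * Real.exp (Real.pi / 2 * ‖(m + n * Complex.I : ℂ)‖ ^ 2) := by
  set l : ℂ := m + n * Complex.I with hl
  have h1 := (differentiable_gaussianSigma l).hasDerivAt.tendsto_slope_zero.norm
  have h0 := (differentiable_gaussianSigma 0).hasDerivAt.tendsto_slope_zero.norm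
  have h2 : Filter.Tendsto
      (fun t : ℂ ↦ Real.exp (Real.pi / 2 * ‖l + t‖ ^ 2 - Real.pi / 2 * ‖t‖ ^ 2))
      (nhdsWithin 0 {0}ᶜ) (nhds (Real.exp (Real.pi / 2 * ‖l‖ ^ 2))) := by
    have : Continuous fun t : ℂ ↦
      Real.exp (Real.pi / 2 * ‖l + t‖ ^ 2 - Real.pi / 2 * ‖t‖ ^ 2) := by fun_prop
    simpa using (this.tendsto 0).mono_left nhdsWithin_le_nhds
  refine tendsto_nhds_unique h1 ((h0.mul h2).congr fun t ↦ ?_)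
  rw [gaussianSigma_zero, hl, gaussianSigma_lattice, ← hl]
  simp only [zero_add, sub_zero, norm_smul]
  rw [norm_gaussianSigma, norm_gaussianSigma, add_comm l t, hl, weightedSigma_add_lattice,
    Real.exp_sub]
  have := Real.exp_ne_zero (Real.pi / 2 * ‖t‖ ^ 2)
  field_simp

/-- The half-integer grid lines reduce modulo the lattice to a compact cross in the unit square,
which contains no zero of sigma. -/
lemma exists_pos_le_weightedSigma : ∃ δ > 0, ∀ z : ℂ,
    (∃ k : ℤ, z.re = k + 1 / 2 ∨ z.im = k + 1 / 2) → δ ≤ weightedSigma z := by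
  set K : Set ℂ := (Set.Icc (0 : ℝ) 1 ×ℂ Set.Icc (0 : ℝ) 1) ∩
    ({z | z.re = 1 / 2} ∪ {z | z.im = 1 / 2}) with hK
  have hKc : IsCompact K := (isCompact_Icc.reProdIm isCompact_Icc).inter_right
    ((isClosed_eq Complex.continuous_re continuous_const).union
      (isClosed_eq Complex.continuous_im continuous_const))
  have half : ∀ k : ℤ, (1 / 2 : ℝ) ≠ k := fun k h ↦ by
    have h2 : (1 : ℝ) = (2 * k : ℤ) := by push_cast; linarith
    have : (1 : ℤ) = 2 * k := by exact_mod_cast h2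
    omega
  have hne : K.Nonempty := ⟨1 / 2, by
    simp only [hK, Set.mem_inter_iff, Complex.mem_reProdIm, Set.mem_union, Set.mem_ofPred_eq]
    norm_num⟩
  obtain ⟨z₀, hz₀, hmin⟩ := hKc.exists_isMinOn hne continuous_weightedSigma.continuousOn
  refine ⟨weightedSigma z₀, ?_, fun z hz ↦ ?_⟩
  · refine lt_of_le_of_ne (by unfold weightedSigma; positivity) (weightedSigma_ne_zero ?_).symm
    rintro m n rfl
    rcases hz₀.2 with h | h
    · exact half m (by simpa using h.symm)
    · exact half n (by simpa using h.symm)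
  · have hmem : z + ((-⌊z.re⌋ : ℤ) + (-⌊z.im⌋ : ℤ) * Complex.I) ∈ K := by
      have h1 := Int.floor_le z.re
      have h2 := Int.lt_floor_add_one z.re
      have h3 := Int.floor_le z.im
      have h4 := Int.lt_floor_add_one z.im
      refine ⟨?_, ?_⟩
      · rw [Complex.mem_reProdIm]
        constructor <;> constructor <;> simp <;> linarith
      · obtain ⟨k, hk | hk⟩ := hz
        · left
          have : ⌊z.re⌋ = k := by rw [Int.floor_eq_iff]; constructor <;> linarith
          rw [Set.mem_ofPred_eq, this]
          simp [hk]
        · right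
          have : ⌊z.im⌋ = k := by rw [Int.floor_eq_iff]; constructor <;> linarith
          rw [Set.mem_ofPred_eq, this]
          simp [hk]
    have := hmin hmem
    rwa [Set.mem_ofPred_eq, weightedSigma_add_lattice] at this

/-! ### Partial fractions and the maximum principle -/

lemma Differentiable.exists_eq_prod_mul {f : ℂ → ℂ} (hf : Differentiable ℂ f) (s : Finset ℂ)
    (hs : ∀ a ∈ s, f a = 0) :
    ∃ g : ℂ → ℂ, Differentiable ℂ g ∧ ∀ z, f z = (∏ a ∈ s, (z - a)) * g z := by
  classical
  induction s using Finset.induction_on generalizing f with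
  | empty => exact ⟨f, hf, by simp⟩
  | insert a s ha ih =>
    have hd : Differentiable ℂ (dslope f a) := by
      rw [← differentiableOn_univ, Complex.differentiableOn_dslope Filter.univ_mem,
        differentiableOn_univ]
      exact hf
    have hfa : f a = 0 := hs a (Finset.mem_insert_self _ _)
    obtain ⟨g, hg, h⟩ := ih hd fun b hb ↦ by
      have hab : b ≠ a := fun h ↦ ha (h ▸ hb)
      rw [dslope_of_ne _ hab, slope_def_field, hs b (Finset.mem_insert_of_mem hb), hfa]
      simp
    refine ⟨g, hg, fun z ↦ ?_⟩
    rw [Finset.prod_insert ha, mul_assoc, ← h]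
    simpa using (sub_smul_dslope_of_zero hfa z).symm

/-- The error of the interpolation of `G` by a partial-fraction expansion of `G / σ`
at the points of `s`. -/
noncomputable def interpolationError (σ G : ℂ → ℂ) (s : Finset ℂ) (z : ℂ) : ℂ :=
  G z / σ z - ∑ a ∈ s, G a / (deriv σ a * (z - a))

/-- The poles at the points of `s` cancel, so the error extends holomorphically across them and the
maximum principle applies. -/
lemma norm_interpolationError_le {σ G : ℂ → ℂ} (hσ : Differentiable ℂ σ) (hG : Differentiable ℂ G)
    {U : Set ℂ} (hU : Bornology.IsBounded U) (s : Finset ℂ) (hs : ∀ a ∈ s, σ a = 0)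
    (hs' : ∀ a ∈ s, deriv σ a ≠ 0) (hz : ∀ z ∈ closure U, σ z = 0 → z ∈ s) {D : ℝ}
    (hD : ∀ z ∈ frontier U, σ z ≠ 0 ∧ ‖interpolationError σ G s z‖ ≤ D) {z : ℂ}
    (hzU : z ∈ closure U) (hz0 : σ z ≠ 0) : ‖interpolationError σ G s z‖ ≤ D := by
  obtain ⟨σ₁, hσ₁, eσ⟩ := hσ.exists_eq_prod_mul s hs
  have hds : ∀ a, Differentiable ℂ (dslope σ a) := fun a ↦ by
    rw [← differentiableOn_univ, Complex.differentiableOn_dslope Filter.univ_mem,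
      differentiableOn_univ]
    exact hσ
  set E : ℂ → ℂ := fun w ↦ G w - ∑ a ∈ s, G a / deriv σ a * dslope σ a w with hE
  have hEd : Differentiable ℂ E := by
    refine hG.sub (Differentiable.fun_sum fun a _ ↦ (hds a).const_mul _)
  have hE0 : ∀ b ∈ s, E b = 0 := fun b hb ↦ by
    simp only [hE]
    rw [Finset.sum_eq_single b, dslope_same, div_mul_cancel₀ _ (hs' b hb), sub_self]
    · intro a ha hab
      rw [dslope_of_ne _ hab.symm, slope_def_field, hs a ha, hs b hb]
      simp
    · exact fun h ↦ absurd hb h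
  obtain ⟨E₁, hE₁, eE⟩ := hEd.exists_eq_prod_mul s hE0
  -- A zero of `σ₁` here would be a multiple zero of `σ`, contradicting `hs'`.
  have hσ₁0 : ∀ w ∈ closure U, σ₁ w ≠ 0 := fun w hw h0 ↦ by
    have hws : w ∈ s := hz w hw (by rw [eσ, h0, mul_zero])
    have hp : Differentiable ℂ fun z : ℂ ↦ ∏ a ∈ s, (z - a) := by fun_prop
    have h := (hp w).hasDerivAt.mul (hσ₁ w).hasDerivAt
    rw [Finset.prod_eq_zero hws (sub_self w), h0, mul_zero, zero_mul, add_zero] at h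
    exact hs' w hws ((h.congr_of_eventuallyEq (.of_forall eσ)).deriv)
  have key : ∀ w, σ w ≠ 0 → interpolationError σ G s w = E₁ w / σ₁ w := fun w hw ↦ by
    have hp : (∏ a ∈ s, (w - a)) ≠ 0 := fun h ↦ hw (by rw [eσ, h, zero_mul])
    rw [← mul_div_mul_left _ _ hp, ← eE, ← eσ, interpolationError, hE, sub_div, Finset.sum_div]
    congr 1
    refine Finset.sum_congr rfl fun a ha ↦ ?_
    have hne : w ≠ a := fun h ↦ hw (h ▸ hs a ha)
    rw [dslope_of_ne _ hne, slope_def_field, hs a ha, sub_zero]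
    have := sub_ne_zero.mpr hne
    have := hs' a ha
    field_simp
  rw [key z hz0]
  refine Complex.norm_le_of_forall_mem_frontier_norm_le hU (f := fun w ↦ E₁ w / σ₁ w) ?_ ?_ hzU
  · exact DifferentiableOn.diffContOnCl (hE₁.differentiableOn.div hσ₁.differentiableOn hσ₁0)
  · intro w hw
    rw [← key w (hD w hw).1]
    exact (hD w hw).2

/-! ### Boxes and lattice sums -/

/-- The open square of side `2N + 1` centred at the origin. -/
def boxRegion (N : ℕ) : Set ℂ :=
  Set.Ioo (-(N + 1 / 2 : ℝ)) (N + 1 / 2) ×ℂ Set.Ioo (-(N + 1 / 2 : ℝ)) (N + 1 / 2)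

/-- The Gaussian integers in `boxRegion N`. -/
noncomputable def boxPoints (N : ℕ) : Finset ℂ :=
  (Finset.Icc (-N : ℤ) N ×ˢ Finset.Icc (-N : ℤ) N).image fun p ↦ (p.1 + p.2 * Complex.I : ℂ)

lemma isBounded_boxRegion (N : ℕ) : Bornology.IsBounded (boxRegion N) :=
  (Metric.isBounded_Ioo _ _).reProdIm (Metric.isBounded_Ioo _ _)

lemma mem_closure_boxRegion {N : ℕ} {z : ℂ} :
    z ∈ closure (boxRegion N) ↔ |z.re| ≤ N + 1 / 2 ∧ |z.im| ≤ N + 1 / 2 := by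
  have h : (-(N + 1 / 2 : ℝ)) ≠ N + 1 / 2 := by
    have : (0 : ℝ) ≤ N := N.cast_nonneg
    linarith
  rw [boxRegion, Complex.closure_reProdIm, closure_Ioo h, Complex.mem_reProdIm, Set.mem_Icc,
    Set.mem_Icc, abs_le, abs_le]

lemma mem_frontier_boxRegion {N : ℕ} {z : ℂ} (hz : z ∈ frontier (boxRegion N)) :
    (∃ k : ℤ, z.re = k + 1 / 2 ∨ z.im = k + 1 / 2) ∧ (N : ℝ) ≤ ‖z‖ := by
  have h0 : (0 : ℝ) ≤ N := N.cast_nonneg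
  have h : (-(N + 1 / 2 : ℝ)) < N + 1 / 2 := by linarith
  rw [boxRegion, Complex.frontier_reProdIm, frontier_Ioo h] at hz
  have hre := Complex.abs_re_le_norm z
  have him := Complex.abs_im_le_norm z
  rcases hz with ⟨-, h | h⟩ | ⟨h | h, -⟩
  -- The lower edge is `-(N + 1/2) = (-N - 1) + 1/2`.
  · refine ⟨⟨-N - 1, Or.inr ?_⟩, ?_⟩
    · push_cast; linarith
    · linarith [neg_abs_le z.im]
  · refine ⟨⟨N, Or.inr ?_⟩, ?_⟩
    · push_cast; exact h
    · rw [Set.mem_singleton_iff] at h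
      linarith [le_abs_self z.im]
  · refine ⟨⟨-N - 1, Or.inl ?_⟩, ?_⟩
    · push_cast; linarith
    · linarith [neg_abs_le z.re]
  · refine ⟨⟨N, Or.inl ?_⟩, ?_⟩
    · push_cast; exact h
    · rw [Set.mem_singleton_iff] at h
      linarith [le_abs_self z.re]

lemma exists_int_of_mem_boxPoints {N : ℕ} {a : ℂ} (ha : a ∈ boxPoints N) :
    ∃ m n : ℤ, a = m + n * Complex.I := by
  obtain ⟨p, -, rfl⟩ := Finset.mem_image.mp ha
  exact ⟨p.1, p.2, rfl⟩

lemma mem_boxPoints_of_mem_closure {N : ℕ} {m n : ℤ}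
    (h : (m + n * Complex.I : ℂ) ∈ closure (boxRegion N)) :
    (m + n * Complex.I : ℂ) ∈ boxPoints N := by
  have hk : ∀ k : ℤ, |(k : ℝ)| ≤ N + 1 / 2 → k ∈ Finset.Icc (-N : ℤ) N := fun k hk ↦ by
    rw [← Int.cast_abs] at hk
    have : ((|k| : ℤ) : ℝ) < ((N + 1 : ℤ) : ℝ) := by push_cast at hk ⊢; linarith
    have : |k| < (N : ℤ) + 1 := by exact_mod_cast this
    rw [Finset.mem_Icc, ← abs_le]
    omega
  rw [mem_closure_boxRegion] at h
  refine Finset.mem_image.mpr ⟨(m, n), Finset.mem_product.mpr ⟨hk m ?_, hk n ?_⟩, rfl⟩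
  · simpa using h.1
  · simpa using h.2

lemma half_le_norm_sub_lattice {z : ℂ} (hz : ∃ k : ℤ, z.re = k + 1 / 2 ∨ z.im = k + 1 / 2)
    (m n : ℤ) : 1 / 2 ≤ ‖z - (m + n * Complex.I)‖ := by
  have key : ∀ k l : ℤ, (1 / 2 : ℝ) ≤ |(k : ℝ) + 1 / 2 - l| := fun k l ↦ by
    rcases le_or_gt l k with h | h
    · have : (l : ℝ) ≤ k := by exact_mod_cast h
      exact le_trans (by linarith) (le_abs_self _)
    · have : (k : ℝ) + 1 ≤ l := by exact_mod_cast h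
      exact le_trans (by linarith) (neg_le_abs _)
  obtain ⟨k, h | h⟩ := hz
  · refine le_trans ?_ (Complex.abs_re_le_norm _)
    simpa [h] using key k m
  · refine le_trans ?_ (Complex.abs_im_le_norm _)
    simpa [h] using key k n

lemma summable_exp_neg_half_pi_sq :
    Summable fun n : ℤ ↦ Real.exp (-(Real.pi / 2 * (n : ℝ) ^ 2)) := by
  -- These are the terms of the Jacobi theta series at `z = 0`, `τ = i/2`.
  have h := ((summable_jacobiTheta₂_term_iff 0 (Complex.I / 2)).mpr (by simp)).norm
  refine h.congr fun n ↦ ?_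
  rw [jacobiTheta₂_term, Complex.norm_exp]
  congr 1
  rw [show (2 * Real.pi * Complex.I * n * 0 + Real.pi * Complex.I * n ^ 2 * (Complex.I / 2) : ℂ) =
    ((-(Real.pi / 2 * (n : ℝ) ^ 2) : ℝ) : ℂ) by
      push_cast; linear_combination (Real.pi / 2 * n ^ 2 : ℂ) * Complex.I_sq, Complex.ofReal_re]

lemma exists_sum_boxPoints_le : ∃ K : ℝ, 0 ≤ K ∧ ∀ N : ℕ,
    ∑ a ∈ boxPoints N, Real.exp (-(Real.pi / 2 * ‖a‖ ^ 2)) ≤ K := by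
  set T := ∑' n : ℤ, Real.exp (-(Real.pi / 2 * (n : ℝ) ^ 2))
  have hT : 0 ≤ T := tsum_nonneg fun n ↦ (Real.exp_pos _).le
  refine ⟨T * T, by positivity, fun N ↦ ?_⟩
  have hs : ∑ n ∈ Finset.Icc (-N : ℤ) N, Real.exp (-(Real.pi / 2 * (n : ℝ) ^ 2)) ≤ T :=
    summable_exp_neg_half_pi_sq.sum_le_tsum _ fun _ _ ↦ (Real.exp_pos _).le
  rw [boxPoints, Finset.sum_image]
  · calc _ = (∑ n ∈ Finset.Icc (-N : ℤ) N, Real.exp (-(Real.pi / 2 * (n : ℝ) ^ 2))) *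
          ∑ n ∈ Finset.Icc (-N : ℤ) N, Real.exp (-(Real.pi / 2 * (n : ℝ) ^ 2)) := by
          rw [Finset.sum_mul_sum, Finset.sum_product]
          refine Finset.sum_congr rfl fun m _ ↦ Finset.sum_congr rfl fun n _ ↦ ?_
          rw [← Real.exp_add, ← Complex.normSq_eq_norm_sq]
          congr 1
          simp [Complex.normSq_apply]
          ring
      _ ≤ _ := by gcongr
  · rintro ⟨a, b⟩ - ⟨c, d⟩ - h
    have h1 := congrArg Complex.re h
    have h2 := congrArg Complex.im h
    simp at h1 h2
    rw [h1, h2]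

/-! ### From lattice values to constancy -/

/-- An entire function whose Gaussian growth rate is below `π / 2` is controlled near the origin by
its values at the Gaussian integers. -/
lemma exists_norm_le_on_unit_box : ∃ A : ℝ, 0 ≤ A ∧ ∀ (G : ℂ → ℂ) (C c d M : ℝ),
    Differentiable ℂ G → c < Real.pi / 2 → 0 ≤ C → 0 ≤ M →
    (∀ z, ‖G z‖ ≤ C * Real.exp (c * ‖z‖ ^ 2 + d * ‖z‖)) →
    (∀ m n : ℤ, ‖G (m + n * Complex.I)‖ ≤ M) → ∀ z ∈ closure (boxRegion 0), ‖G z‖ ≤ A * M := by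
  obtain ⟨δ, hδ, hδσ⟩ := exists_pos_le_weightedSigma
  obtain ⟨K, hK0, hK⟩ := exists_sum_boxPoints_le
  set s := ‖deriv gaussianSigma 0‖ with hs
  have hs0 : 0 < s := norm_pos_iff.mpr deriv_gaussianSigma_zero_ne_zero
  obtain ⟨B, hB⟩ := (isBounded_boxRegion 0).isCompact_closure.exists_bound_of_continuousOn
    differentiable_gaussianSigma.continuous.continuousOn
  have hB0 : 0 ≤ B := (norm_nonneg _).trans (hB 0 (by rw [mem_closure_boxRegion]; simp))
  -- The partial-fraction sum is at most `2MK/s` on grid lines. It enters twice: in the error on the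
  -- large boundary, and at the point itself.
  refine ⟨B * (4 * K / s), by positivity, fun G C c d M hG hc hC hM hgrow hlat z hz ↦ ?_⟩
  set κ := Real.pi / 2 - c with hκ
  have hκ0 : 0 < κ := sub_pos.mpr hc
  have hσne : ∀ z : ℂ, (∃ k : ℤ, z.re = k + 1 / 2 ∨ z.im = k + 1 / 2) → gaussianSigma z ≠ 0 := by
    intro z hz h0
    have := hδσ z hz
    rw [weightedSigma, h0, norm_zero, zero_mul] at this
    linarith
  have hsum : ∀ (N : ℕ) (z : ℂ), (∃ k : ℤ, z.re = k + 1 / 2 ∨ z.im = k + 1 / 2) →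
      ‖∑ a ∈ boxPoints N, G a / (deriv gaussianSigma a * (z - a))‖ ≤ 2 * M / s * K := by
    intro N z hz
    calc _ ≤ ∑ a ∈ boxPoints N, 2 * M / s * Real.exp (-(Real.pi / 2 * ‖a‖ ^ 2)) := by
          refine norm_sum_le_of_le _ fun a ha ↦ ?_
          obtain ⟨m, n, rfl⟩ := exists_int_of_mem_boxPoints ha
          have h1 := half_le_norm_sub_lattice hz m n
          rw [norm_div, norm_mul, norm_deriv_gaussianSigma_lattice, Real.exp_neg, ← hs]
          calc _ ≤ M / (s * Real.exp (Real.pi / 2 * ‖(m + n * Complex.I : ℂ)‖ ^ 2) * (1 / 2)) := by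
                gcongr
                exact hlat m n
            _ = _ := by field_simp
      _ = 2 * M / s * ∑ a ∈ boxPoints N, Real.exp (-(Real.pi / 2 * ‖a‖ ^ 2)) := by
          rw [Finset.mul_sum]
      _ ≤ _ := by gcongr; exact hK N
  -- Half of the gap `κ` absorbs the linear term, as `d|w| - κ|w|²/2 ≤ d²/(2κ)`; the other half
  -- gives decay in `N`.
  set ε : ℕ → ℝ := fun N ↦ C / δ * Real.exp (d ^ 2 / (2 * κ)) * Real.exp (-(κ / 2 * (N : ℝ) ^ 2))
    with hε
  have hεlim : Filter.Tendsto (fun N ↦ ε N + 4 * M * K / s) Filter.atTop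
      (nhds (0 + 4 * M * K / s)) := by
    refine Filter.Tendsto.add_const _ ?_
    rw [← mul_zero (C / δ * Real.exp (d ^ 2 / (2 * κ)))]
    refine Filter.Tendsto.const_mul _ (Real.tendsto_exp_neg_atTop_nhds_zero.comp ?_)
    exact ((Filter.tendsto_pow_atTop two_ne_zero).comp tendsto_natCast_atTop_atTop).const_mul_atTop
      (by positivity)
  have hfront : ∀ (N : ℕ), ∀ w ∈ frontier (boxRegion N), ‖G w / gaussianSigma w‖ ≤ ε N := by
    intro N w hw
    obtain ⟨hgrid, hN⟩ := mem_frontier_boxRegion hw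
    rw [norm_div, norm_gaussianSigma]
    have h1 : c * ‖w‖ ^ 2 + d * ‖w‖ - Real.pi / 2 * ‖w‖ ^ 2 ≤
        d ^ 2 / (2 * κ) + -(κ / 2 * (N : ℝ) ^ 2) := by
      have h2 : (N : ℝ) ^ 2 ≤ ‖w‖ ^ 2 := by gcongr
      have h3 : d ^ 2 / (2 * κ) - d * ‖w‖ + κ / 2 * ‖w‖ ^ 2 = (d - κ * ‖w‖) ^ 2 / (2 * κ) := by
        field_simp
        ring
      have h4 : 0 ≤ (d - κ * ‖w‖) ^ 2 / (2 * κ) := by positivity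
      have h5 : κ / 2 * (N : ℝ) ^ 2 ≤ κ / 2 * ‖w‖ ^ 2 := by gcongr
      have h6 : κ * ‖w‖ ^ 2 = Real.pi / 2 * ‖w‖ ^ 2 - c * ‖w‖ ^ 2 := by rw [hκ]; ring
      linarith
    calc _ ≤ C * Real.exp (c * ‖w‖ ^ 2 + d * ‖w‖) / (δ * Real.exp (Real.pi / 2 * ‖w‖ ^ 2)) := by
          gcongr
          · exact hgrow w
          · exact hδσ w hgrid
      _ = C / δ * Real.exp (c * ‖w‖ ^ 2 + d * ‖w‖ - Real.pi / 2 * ‖w‖ ^ 2) := by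
          rw [Real.exp_sub]
          field_simp
      _ ≤ C / δ * Real.exp (d ^ 2 / (2 * κ) + -(κ / 2 * (N : ℝ) ^ 2)) := by gcongr
      _ = ε N := by rw [Real.exp_add, hε]; ring
  have herr : ∀ (N : ℕ) (w : ℂ), w ∈ closure (boxRegion N) → gaussianSigma w ≠ 0 →
      ‖interpolationError gaussianSigma G (boxPoints N) w‖ ≤ ε N + 2 * M / s * K := by
    intro N w hw hw0
    refine norm_interpolationError_le differentiable_gaussianSigma hG (isBounded_boxRegion N)
      (boxPoints N) ?_ ?_ ?_ ?_ hw hw0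
    · intro a ha
      obtain ⟨m, n, rfl⟩ := exists_int_of_mem_boxPoints ha
      exact gaussianSigma_lattice m n
    · intro a ha
      obtain ⟨m, n, rfl⟩ := exists_int_of_mem_boxPoints ha
      rw [← norm_ne_zero_iff, norm_deriv_gaussianSigma_lattice]
      positivity
    · intro a ha ha0
      obtain ⟨m, n, rfl⟩ := eq_lattice_of_gaussianSigma_eq_zero ha0
      exact mem_boxPoints_of_mem_closure ha
    · intro v hv
      obtain ⟨hgrid, -⟩ := mem_frontier_boxRegion hv
      exact ⟨hσne v hgrid, (norm_sub_le _ _).trans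
        (add_le_add (hfront N v hv) (hsum N v hgrid))⟩
  -- Sigma vanishes at 0, inside the box, so the quotient is estimated only on the frontier.
  refine Complex.norm_le_of_forall_mem_frontier_norm_le (isBounded_boxRegion 0) hG.diffContOnCl
    (fun w hw ↦ ?_) hz
  obtain ⟨hgrid, -⟩ := mem_frontier_boxRegion hw
  have hw0 := frontier_subset_closure hw
  have hquot : ‖G w / gaussianSigma w‖ ≤ 0 + 4 * M * K / s := by
    refine ge_of_tendsto' hεlim fun N ↦ ?_
    have hwN : w ∈ closure (boxRegion N) := by
      rw [mem_closure_boxRegion] at hw0 ⊢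
      have h0 : (0 : ℝ) ≤ N := N.cast_nonneg
      norm_num at hw0 ⊢
      constructor <;> linarith [hw0.1, hw0.2]
    have h1 := herr N w hwN (hσne w hgrid)
    have h2 := hsum N w hgrid
    have h3 : G w / gaussianSigma w = interpolationError gaussianSigma G (boxPoints N) w +
        ∑ a ∈ boxPoints N, G a / (deriv gaussianSigma a * (w - a)) := by
      rw [interpolationError, sub_add_cancel]
    rw [h3]
    refine (norm_add_le _ _).trans ((add_le_add h1 h2).trans_eq ?_)
    ring
  calc ‖G w‖ = ‖gaussianSigma w‖ * ‖G w / gaussianSigma w‖ := by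
        rw [← norm_mul, mul_div_cancel₀ _ (hσne w hgrid)]
    _ ≤ B * (0 + 4 * M * K / s) := by gcongr; exact hB w hw0
    _ = _ := by ring

/-- An entire function whose Gaussian growth rate is below `π / 2` and which is bounded on the
Gaussian integers is constant. -/
theorem Differentiable.exists_const_of_bounded_on_gaussian_integers {G : ℂ → ℂ} {C c d M : ℝ}
    (hG : Differentiable ℂ G) (hc0 : 0 ≤ c) (hc : c < Real.pi / 2) (hd : 0 ≤ d) (hC : 0 ≤ C)
    (hM : 0 ≤ M) (hgrow : ∀ z, ‖G z‖ ≤ C * Real.exp (c * ‖z‖ ^ 2 + d * ‖z‖))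
    (hlat : ∀ m n : ℤ, ‖G (m + n * Complex.I)‖ ≤ M) : ∃ k, ∀ z, G z = k := by
  obtain ⟨A, -, hA⟩ := exists_norm_le_on_unit_box
  refine hG.exists_const_forall_eq_of_bounded (isBounded_iff_forall_norm_le.mpr ⟨A * M, ?_⟩)
  rintro _ ⟨z, rfl⟩
  set l : ℂ := round z.re + round z.im * Complex.I with hl
  have hbox : z - l ∈ closure (boxRegion 0) := by
    rw [mem_closure_boxRegion]
    simpa [hl] using And.intro (abs_sub_round z.re) (abs_sub_round z.im)
  -- Translation by `l` enlarges `C` and `d` but keeps the rate `c`, so the bound `A * M` is uniform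
  -- in `l`.
  have h := hA (fun w ↦ G (w + l)) (C * Real.exp (c * ‖l‖ ^ 2 + d * ‖l‖)) c (2 * c * ‖l‖ + d) M
    (hG.comp (differentiable_id.add_const l)) hc (by positivity) hM ?_ ?_ _ hbox
  · simpa using h
  · intro w
    refine (hgrow _).trans ?_
    rw [mul_assoc, ← Real.exp_add]
    have h1 := norm_add_le w l
    refine mul_le_mul_of_nonneg_left (Real.exp_le_exp.mpr ?_) hC
    calc c * ‖w + l‖ ^ 2 + d * ‖w + l‖ ≤ c * (‖w‖ + ‖l‖) ^ 2 + d * (‖w‖ + ‖l‖) := by gcongr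
      _ = _ := by ring
  · intro m n
    have := hlat (m + round z.re) (n + round z.im)
    convert this using 3
    rw [hl]
    push_cast
    ring

/-! ### The Bargmann transform of the Gaussian, and growth in Fock space -/

/-- Completing the square cancels the exponent in `z`; the constants give `2^(1/4) * 2^(1/4) *
2^(-1/2) = 1`. -/
lemma bargmann_normalizedGaussian (z : ℂ) : bargmann normalizedGaussian z = 1 := by
  have h : ∀ t : ℝ, normalizedGaussian t *
      Complex.exp (2 * Real.pi * t * z - Real.pi * t ^ 2 - Real.pi / 2 * z ^ 2) =
      (((2 : ℝ) ^ (1 / 4 : ℝ) : ℝ) : ℂ) * Complex.exp ((-2 * Real.pi : ℂ) * t ^ 2 +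
        (2 * Real.pi * z) * t + -(Real.pi / 2 * z ^ 2)) := fun t ↦ by
    rw [normalizedGaussian, Complex.ofReal_mul, mul_assoc, Complex.ofReal_exp, ← Complex.exp_add]
    congr 2
    push_cast
    ring
  unfold bargmann
  simp_rw [h]
  rw [integral_const_mul, integral_cexp_quadratic (by simp [Real.pi_pos])]
  have hpi : (Real.pi : ℂ) ≠ 0 := by simp [Real.pi_ne_zero]
  have e1 : -(Real.pi / 2 * z ^ 2) - (2 * Real.pi * z) ^ 2 / (4 * (-2 * Real.pi)) = 0 := by
    field_simp
    ring
  have e2 : (Real.pi : ℂ) / -(-2 * Real.pi) = ((2⁻¹ : ℝ) : ℂ) := by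
    push_cast
    field_simp
  have e3 : (1 / 2 : ℂ) = ((1 / 2 : ℝ) : ℂ) := by push_cast; rfl
  rw [e1, Complex.exp_zero, mul_one, e2, e3, ← Complex.ofReal_cpow (by norm_num),
    ← Complex.ofReal_mul, ← Complex.ofReal_mul, ← mul_assoc, ← Real.rpow_add (by norm_num),
    Real.inv_rpow (by norm_num)]
  norm_num

/-- Mean value property of the entire function `F ^ 2`. -/
lemma le_lintegral_circleMap {F : ℂ → ℂ} (hF : Differentiable ℂ F) (z : ℂ) (r : ℝ) :
    ENNReal.ofReal (2 * Real.pi * ‖F z‖ ^ 2) ≤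
      ∫⁻ θ in Set.Ioo (-Real.pi) Real.pi, ENNReal.ofReal (‖F (circleMap z r θ)‖ ^ 2) := by
  have hc : Continuous fun θ ↦ F (circleMap z r θ) := hF.continuous.comp (continuous_circleMap z r)
  have hmean := (DiffContOnCl.circleAverage (R := r) (c := z) (hF.pow 2).diffContOnCl)
  rw [Real.circleAverage_eq_integral_add (-Real.pi),
    intervalIntegral.integral_comp_add_right (fun θ ↦ (F ^ 2) (circleMap z r θ)),
    show (0 : ℝ) + -Real.pi = -Real.pi by ring, show 2 * Real.pi + -Real.pi = Real.pi by ring,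
    inv_smul_eq_iff₀ (by positivity)] at hmean
  have hnorm : 2 * Real.pi * ‖F z‖ ^ 2 ≤ ∫ θ in -Real.pi..Real.pi, ‖F (circleMap z r θ)‖ ^ 2 := by
    have h := intervalIntegral.norm_integral_le_integral_norm (μ := volume)
      (f := fun θ ↦ (F ^ 2) (circleMap z r θ)) (neg_le_self Real.pi_pos.le)
    rw [hmean, norm_smul] at h
    simpa [abs_of_pos Real.pi_pos] using h
  refine (ENNReal.ofReal_le_ofReal hnorm).trans ?_
  rw [intervalIntegral.integral_of_le (neg_le_self Real.pi_pos.le), integral_Ioc_eq_integral_Ioo,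
    ofReal_integral_eq_lintegral_ofReal]
  · exact ((hc.norm.pow 2).integrableOn_Icc (a := -Real.pi) (b := Real.pi)).mono_set
      Set.Ioo_subset_Icc_self
  · exact .of_forall fun θ ↦ by positivity

/-- Restrict the integral to the annulus `1/2 < r < 1` about `z`. There the Jacobian `r` is at least
`1/2`, and the weight at least `exp(-π(|z| + 1)²)`; the last `1/2` is the radial length. -/
lemma le_fockNormSq {F : ℂ → ℂ} (hF : Differentiable ℂ F) (z : ℂ) :
    ENNReal.ofReal (1 / 2 * Real.exp (-Real.pi * (‖z‖ + 1) ^ 2)) *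
      ENNReal.ofReal (2 * Real.pi * ‖F z‖ ^ 2) * ENNReal.ofReal (1 / 2) ≤ fockNormSq F := by
  set f : ℂ → ENNReal := fun w ↦ ENNReal.ofReal (‖F w‖ ^ 2 * Real.exp (-Real.pi * ‖w‖ ^ 2)) with hf
  set K : ENNReal := ENNReal.ofReal (1 / 2 * Real.exp (-Real.pi * (‖z‖ + 1) ^ 2)) with hK
  set g : ℝ × ℝ → ENNReal := fun p ↦ ENNReal.ofReal (‖F (circleMap z p.1 p.2)‖ ^ 2) with hg
  have hgm : Measurable g :=
    ((hF.continuous.comp (by fun_prop [circleMap] :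
      Continuous fun p : ℝ × ℝ ↦ circleMap z p.1 p.2)).norm.pow 2).measurable.ennreal_ofReal
  have h1 : fockNormSq F = ∫⁻ p in polarCoord.target,
      ENNReal.ofReal p.1 • f (z + Complex.polarCoord.symm p) := by
    rw [Complex.lintegral_comp_polarCoord_symm (fun w ↦ f (z + w)), lintegral_add_left_eq_self f z]
    rfl
  have hsub : Set.Ioo (1 / 2 : ℝ) 1 ×ˢ Set.Ioo (-Real.pi) Real.pi ⊆ polarCoord.target :=
    Set.prod_mono (fun r hr ↦ lt_trans (by norm_num) hr.1) subset_rfl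
  have h2 : ∀ p ∈ Set.Ioo (1 / 2 : ℝ) 1 ×ˢ Set.Ioo (-Real.pi) Real.pi,
      K * g p ≤ ENNReal.ofReal p.1 • f (z + Complex.polarCoord.symm p) := by
    rintro ⟨r, θ⟩ ⟨⟨hr1, hr2⟩, -⟩
    have hr0 : 0 ≤ r := by dsimp only at hr1; linarith
    have e : z + Complex.polarCoord.symm (r, θ) = circleMap z r θ := by
      rw [Complex.polarCoord_symm_apply, circleMap, Complex.exp_mul_I]
      push_cast
      rfl
    rw [e, smul_eq_mul, hK, hg, hf, ← ENNReal.ofReal_mul (by positivity), ← ENNReal.ofReal_mul hr0]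
    refine ENNReal.ofReal_le_ofReal ?_
    have hn : ‖circleMap z r θ‖ ≤ ‖z‖ + 1 := by
      have : ‖circleMap z r θ - z‖ = |r| := by simp [circleMap]
      rw [abs_of_nonneg hr0] at this
      have := norm_le_norm_add_norm_sub' (circleMap z r θ) z
      dsimp only at hr2
      linarith
    have he : Real.exp (-Real.pi * (‖z‖ + 1) ^ 2) ≤
        Real.exp (-Real.pi * ‖circleMap z r θ‖ ^ 2) := by
      refine Real.exp_le_exp.mpr ?_
      have := pow_le_pow_left₀ (norm_nonneg _) hn 2
      nlinarith [Real.pi_pos]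
    calc _ = 1 / 2 * (‖F (circleMap z r θ)‖ ^ 2 * Real.exp (-Real.pi * (‖z‖ + 1) ^ 2)) := by ring
      _ ≤ _ := by dsimp only at hr1 ⊢; gcongr
  calc _ = ∫⁻ _r in Set.Ioo (1 / 2 : ℝ) 1, K * ENNReal.ofReal (2 * Real.pi * ‖F z‖ ^ 2) := by
        rw [setLIntegral_const, Real.volume_Ioo]
        norm_num
    _ ≤ ∫⁻ r in Set.Ioo (1 / 2 : ℝ) 1, ∫⁻ θ in Set.Ioo (-Real.pi) Real.pi, K * g (r, θ) := by
        refine lintegral_mono fun r ↦ ?_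
        rw [lintegral_const_mul K (f := fun θ ↦ g (r, θ)) (hgm.comp measurable_prodMk_left)]
        exact mul_le_mul_right (le_lintegral_circleMap hF z r) _
    _ = ∫⁻ p in Set.Ioo (1 / 2 : ℝ) 1 ×ˢ Set.Ioo (-Real.pi) Real.pi, K * g p := by
        rw [Measure.volume_eq_prod, setLIntegral_prod _ (hgm.const_mul K).aemeasurable]
    _ ≤ ∫⁻ p in Set.Ioo (1 / 2 : ℝ) 1 ×ˢ Set.Ioo (-Real.pi) Real.pi,
          ENNReal.ofReal p.1 • f (z + Complex.polarCoord.symm p) :=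
        setLIntegral_mono' (measurableSet_Ioo.prod measurableSet_Ioo) h2
    _ ≤ _ := by
        rw [h1]
        exact lintegral_mono_set hsub

lemma exists_norm_le_of_mem_fockSpace {F : ℂ → ℂ} (hF : F ∈ fockSpace) :
    ∃ C, 0 ≤ C ∧ ∀ z, ‖F z‖ ≤ C * Real.exp (Real.pi / 2 * (‖z‖ + 1) ^ 2) := by
  obtain ⟨hd, hfin⟩ := hF
  set A := (fockNormSq F).toReal with hA
  have hA0 : 0 ≤ A := ENNReal.toReal_nonneg
  refine ⟨√A, Real.sqrt_nonneg _, fun z ↦ ?_⟩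
  have h := le_fockNormSq hd z
  rw [← ENNReal.ofReal_mul (by positivity), ← ENNReal.ofReal_mul (by positivity),
    ENNReal.ofReal_le_iff_le_toReal hfin.ne, ← hA] at h
  have h2 : ‖F z‖ ^ 2 ≤ A * Real.exp (Real.pi * (‖z‖ + 1) ^ 2) := by
    have hx : Real.exp (-Real.pi * (‖z‖ + 1) ^ 2) * Real.exp (Real.pi * (‖z‖ + 1) ^ 2) = 1 := by
      rw [← Real.exp_add]; simp
    have h3 : Real.exp (-Real.pi * (‖z‖ + 1) ^ 2) * ‖F z‖ ^ 2 ≤ A := by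
      refine le_trans ?_ h
      have : 0 ≤ Real.exp (-Real.pi * (‖z‖ + 1) ^ 2) * ‖F z‖ ^ 2 := by positivity
      -- The constant is `1/2 * 2π * 1/2 = π/2 ≥ 1`, so it can be dropped.
      nlinarith [Real.pi_gt_three]
    calc ‖F z‖ ^ 2 = Real.exp (-Real.pi * (‖z‖ + 1) ^ 2) * ‖F z‖ ^ 2 *
          Real.exp (Real.pi * (‖z‖ + 1) ^ 2) := by linear_combination -‖F z‖ ^ 2 * hx
      _ ≤ _ := by gcongr
  refine le_of_sq_le_sq ?_ (by positivity)
  rw [mul_pow, Real.sq_sqrt hA0, ← Real.exp_nat_mul]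
  refine h2.trans_eq ?_
  congr 2
  push_cast
  ring

/-! ### The theorem -/

theorem corollary2p3 (a : ℝ) (ha0 : 0 < a) (ha1 : a < 1) :
    (∀ z ∈ squareLattice a, ‖bargmann normalizedGaussian z‖ = 1) ∧
      ∀ F ∈ fockSpace, (∀ z ∈ squareLattice a, ‖F z‖ = 1) →
        ∃ α : ℝ, ∀ z : ℂ, F z = Complex.exp (Complex.I * α) := by
  refine ⟨fun z _ ↦ by rw [bargmann_normalizedGaussian, norm_one], fun F hF hlat ↦ ?_⟩
  obtain ⟨C, hC, hgrow⟩ := exists_norm_le_of_mem_fockSpace hF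
  have ha : (a : ℂ) ≠ 0 := by exact_mod_cast ha0.ne'
  -- The constants come from expanding `π/2 (a|z| + 1)²`; `a < 1` puts the rate below `π/2`.
  obtain ⟨k, hk⟩ := Differentiable.exists_const_of_bounded_on_gaussian_integers
    (G := fun z ↦ F (a * z)) (C := C * Real.exp (Real.pi / 2)) (c := Real.pi / 2 * a ^ 2)
    (d := Real.pi * a) (M := 1) (hF.1.comp (differentiable_id.const_mul _)) (by positivity)
    (by nlinarith [Real.pi_pos, mul_pos ha0 (sub_pos.mpr ha1)]) (by positivity) (by positivity)
    zero_le_one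
    (fun z ↦ by
      refine (hgrow _).trans_eq ?_
      rw [mul_assoc, ← Real.exp_add, norm_mul, Complex.norm_real, Real.norm_of_nonneg ha0.le]
      congr 2
      ring)
    (fun m n ↦ (hlat _ ⟨m, n, by ring⟩).le)
  have hFk : ∀ z, F z = k := fun z ↦ by
    rw [← hk (z / a), mul_div_cancel₀ _ ha]
  have hk1 : ‖k‖ = 1 := by
    rw [← hFk 0]
    exact hlat 0 ⟨0, 0, by simp⟩
  refine ⟨k.arg, fun z ↦ ?_⟩
  rw [hFk, mul_comm]
  simpa [hk1] using (Complex.norm_mul_exp_arg_mul_I k).symm
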